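/- Let $n\ge 1$. Formulas of $\mathcal R$Ł in the variables $v_1,\dots,v_n$ are built with $\neg$, $\to$ and unary connectives $\nabla_r$ ($r\in[0,1]$). Put $\Delta_r\varphi=\neg\nabla_r\neg\varphi$, and on $[0,1]$ put $x^*=1-x$, $x\oplus y=\min(1,x+y)$, $x\odot y=(x^*\oplus y^*)^*$. The axioms are those of Łukasiewicz logic, $$\varphi\to(\psi\to\varphi),\quad (\varphi\to\psi)\to((\psi\to\chi)\to(\varphi\to\chi)),\quad ((\varphi\to\psi)\to\psi)\to((\psi\to\varphi)\to\varphi),\quad (\neg\varphi\to\neg\psi)\to(\psi\to\varphi),$$ together with $$\nabla_r(\varphi\to\psi)\leftrightarrow(\nabla_r\varphi\to\nabla_r\psi),\quad \nabla_{r\odot q^*}\varphi\leftrightarrow(\nabla_q\varphi\to\nabla_r\varphi),\quad \nabla_r\nabla_q\varphi\leftrightarrow\nabla_{rq}\varphi,\quad \nabla_1\varphi\leftrightarrow\varphi ;$$ the only rule is modus ponens. The term function $f_\varphi:[0,1]^n\to[0,1]$ interprets $\neg a$ as $1-a$, $a\to b$ as $\min(1,1-a+b)$ and $\nabla_r a$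 as $1-r(1-a)$. Let $RL_n$ be the Lindenbaum–Tarski algebra, i.e. the set of classes $[\varphi]$ of formulas modulo provable equivalence, with $0=[\neg(v_1\to v_1)]$, $[\varphi]^*=[\neg\varphi]$, $[\varphi]\oplus[\psi]=[\neg\varphi\to\psi]$ and $r[\varphi]=[\Delta_r\varphi]$. Let $$\|[\varphi]\|_u=\sup\{f_\varphi(\mathbf x)\mid \mathbf x\in[0,1]^n\},\qquad \rho(x,y)=\|(x\odot y^*)\oplus(x^*\odot y)\|_u .$$ Then: (1) $\|\cdot\|_u$ is a norm on $RL_n$: it takes values in $[0,1]$, $\|x\|_u=0$ iff $x=0$, $\|rx\|_u=r\|x\|_u$ for $r\in[0,1]$, $\|x\oplus y\|_u\le\|x\|_u+\|y\|_u$, and $\|x\|_u\le\|y\|_u$ whenever $x\le y$ (that is, $x^*\oplus y=0^*$). (2) The norm-completion of $(RL_n,\|\cdot\|_u)$, i.e. its metric completion with respect to $\rho$, with the operations and the norm extended by continuity, is isometrically isomorphic to $(C([0,1]^n),\|\cdot\|_\infty)$, where $C([0,1]^n)$ is the set of all continuous functions $[0,1]^n\to[0,1]$ with the pointwise operations $0$,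 $^*$, $\oplus$ and multiplication by scalars $r\in[0,1]$: there is a bijection from the completion onto $C([0,1]^n)$ that is an isometry for the metrics, preserves the norms, commutes with all these operations, and sends $[\varphi]$ to $f_\varphi$ for every formula $\varphi$. (3) Consequently, for every continuous $f:[0,1]^n\to[0,1]$ there is a sequence $(\varphi_k)_{k\in\mathbb N}$ of formulas of $\mathcal R$Ł in $v_1,\dots,v_n$ such that $f_{\varphi_k}\to f$ uniformly on $[0,1]^n$. -/

import Mathlib

open Filter Topology unitInterval UniformSpace

noncomputable section

namespace RieszLuk

/-! ### The signature of Riesz MV-algebras and the derived operations -/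

/-- The operations `0`, `x*`, `x ⊕ y` and `r x` (`r ∈ [0,1]`) of a Riesz MV-algebra. This class is
only used for the concrete algebras below. -/
class RieszMVOps (A : Type*) where
  zero : A
  mvStar : A → A
  oplus : A → A → A
  scal : I → A → A

open RieszMVOps

/-- `x ⊙ y = (x* ⊕ y*)*`. -/
def odot {A : Type*} [RieszMVOps A] (x y : A) : A := mvStar (oplus (mvStar x) (mvStar y))

/-- Chang's distance `d(x,y) = (x ⊙ y*) ⊕ (x* ⊙ y)`. -/
def changDist {A : Type*} [RieszMVOps A] (x y : A) : A :=
  oplus (odot x (mvStar y)) (odot (mvStar x) y)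

/-- The natural order: `x ≤ y` iff `x* ⊕ y = 1 = 0*`. -/
def mvLE {A : Type*} [RieszMVOps A] (x y : A) : Prop := oplus (mvStar x) y = mvStar (zero : A)

/-- A norm on a Riesz MV-algebra, with values in `[0,1]`. -/
structure IsRieszMVNorm {A : Type*} [RieszMVOps A] (N : A → ℝ) : Prop where
  mem_Icc : ∀ x, N x ∈ Set.Icc (0 : ℝ) 1
  eq_zero_iff : ∀ x, N x = 0 ↔ x = zero
  scal_eq : ∀ (r : I) (x : A), N (scal r x) = r * N x
  oplus_le : ∀ x y, N (oplus x y) ≤ N x + N y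
  mono : ∀ x y, mvLE x y → N x ≤ N y

/-- An isomorphism of Riesz MV-algebras: a bijection that commutes with all operations. -/
structure IsRieszMVIso {A B : Type*} [RieszMVOps A] [RieszMVOps B] (Φ : A → B) : Prop where
  bijective : Function.Bijective Φ
  map_zero : Φ zero = zero
  map_star : ∀ x, Φ (mvStar x) = mvStar (Φ x)
  map_oplus : ∀ x y, Φ (oplus x y) = oplus (Φ x) (Φ y)
  map_scal : ∀ (r : I) (x : A), Φ (scal r x) = scal r (Φ x)

/-- The standard algebra `[0,1]`: `x* = 1 - x`, `x ⊕ y = min (1, x + y)`, `r x` the product. -/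
instance : RieszMVOps I where
  zero := 0
  mvStar x := ⟨1 - x, by have := x.2.1; have := x.2.2; constructor <;> linarith⟩
  oplus x y := ⟨min 1 (x + y), by
    have := x.2.1; have := y.2.1
    exact ⟨le_min zero_le_one (by linarith), min_le_left _ _⟩⟩
  scal r x := r * x

@[simp] theorem coe_zero_I : ((zero : I) : ℝ) = 0 := rfl
@[simp] theorem coe_star_I (x : I) : ((mvStar x : I) : ℝ) = 1 - x := rfl
@[simp] theorem coe_oplus_I (x y : I) : ((oplus x y : I) : ℝ) = min 1 ((x : ℝ) + y) := rfl
@[simp] theorem coe_scal_I (r x : I) : ((scal r x : I) : ℝ) = r * x := rfl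

theorem continuous_star_I : Continuous (mvStar : I → I) :=
  (continuous_const.sub continuous_subtype_val).subtype_mk _

theorem continuous_oplus_I : Continuous fun p : I × I => oplus p.1 p.2 :=
  (continuous_const.min ((continuous_subtype_val.comp continuous_fst).add
    (continuous_subtype_val.comp continuous_snd))).subtype_mk _

theorem continuous_scal_I (r : I) : Continuous (scal r : I → I) :=
  continuous_const.mul continuous_id

/-- `[0,1]`-valued continuous functions, with the pointwise operations. -/
instance {X : Type*} [TopologicalSpace X] : RieszMVOps C(X, I) where
  zero := ⟨fun _ => zero, continuous_const⟩
  mvStar f := ⟨fun x => mvStar (f x), continuous_star_I.comp f.continuous⟩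
  oplus f g := ⟨fun x => oplus (f x) (g x),
    continuous_oplus_I.comp (f.continuous.prodMk g.continuous)⟩
  scal r f := ⟨fun x => scal r (f x), (continuous_scal_I r).comp f.continuous⟩

/-- The sup norm `‖f‖_∞` of a `[0,1]`-valued continuous function. -/
def supNorm {X : Type*} [TopologicalSpace X] (f : C(X, I)) : ℝ := ⨆ x, (f x : ℝ)

/-! ### The logic: formulas, theorems, term functions -/

/-- Formulas in the `n` variables `v_0, …, v_{n-1}` over the connectives `¬`, `→`, `∇_r`. -/
inductive Form (n : ℕ) : Type
  | var : Fin n → Form n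
  | neg : Form n → Form n
  | imp : Form n → Form n → Form n
  | nabla : I → Form n → Form n

namespace Form

/-- `Δ_r φ = ¬ ∇_r ¬ φ`. -/
def delta {n : ℕ} (r : I) (φ : Form n) : Form n := neg (nabla r (neg φ))

/-- The value `f_φ(x)` of the term function: `¬a = 1 - a`, `a → b = a* ⊕ b = min (1, 1 - a + b)`,
and `∇_r a = (r a*)*`, the operation dual to the product by `r`. -/
def eval {n : ℕ} (x : Fin n → I) : Form n → I
  | var i => x i
  | neg φ => mvStar (eval x φ)
  | imp φ ψ => oplus (mvStar (eval x φ)) (eval x ψ)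
  | nabla r φ => mvStar (scal r (mvStar (eval x φ)))

theorem continuous_eval {n : ℕ} (φ : Form n) : Continuous fun x : Fin n → I => eval x φ := by
  induction φ with
  | var i => exact continuous_apply i
  | neg φ ih => exact continuous_star_I.comp ih
  | imp φ ψ ih₁ ih₂ => exact continuous_oplus_I.comp ((continuous_star_I.comp ih₁).prodMk ih₂)
  | nabla r φ ih =>
    exact continuous_star_I.comp ((continuous_scal_I r).comp (continuous_star_I.comp ih))

/-- The term function `f_φ : [0,1]^n → [0,1]`. -/
def termFun {n : ℕ} (φ : Form n) : C(Fin n → I, I) := ⟨fun x => eval x φ, continuous_eval φ⟩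

end Form

open Form

/-- The theorems of the logic. An axiom `α ↔ β` is entered as the two axioms `α → β` and `β → α`.
The only rule is modus ponens. -/
inductive Provable {n : ℕ} : Form n → Prop
  | L1 (φ ψ) : Provable (imp φ (imp ψ φ))
  | L2 (φ ψ χ) : Provable (imp (imp φ ψ) (imp (imp ψ χ) (imp φ χ)))
  | L3 (φ ψ) : Provable (imp (imp (imp φ ψ) ψ) (imp (imp ψ φ) φ))
  | L4 (φ ψ) : Provable (imp (imp (neg φ) (neg ψ)) (imp ψ φ))
  | R1 (r φ ψ) : Provable (imp (nabla r (imp φ ψ)) (imp (nabla r φ) (nabla r ψ)))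
  | R1' (r φ ψ) : Provable (imp (imp (nabla r φ) (nabla r ψ)) (nabla r (imp φ ψ)))
  | R2 (r q φ) : Provable (imp (nabla (odot r (mvStar q)) φ) (imp (nabla q φ) (nabla r φ)))
  | R2' (r q φ) : Provable (imp (imp (nabla q φ) (nabla r φ)) (nabla (odot r (mvStar q)) φ))
  | R3 (r q φ) : Provable (imp (nabla r (nabla q φ)) (nabla (r * q) φ))
  | R3' (r q φ) : Provable (imp (nabla (r * q) φ) (nabla r (nabla q φ)))
  | R4 (φ) : Provable (imp (nabla 1 φ) φ)
  | R4' (φ) : Provable (imp φ (nabla 1 φ))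
  | mp {φ ψ} : Provable (imp φ ψ) → Provable φ → Provable ψ

namespace Provable

variable {n : ℕ} {φ ψ χ φ' ψ' : Form n}

theorem eval_imp_eq_one {x : Fin n → I} :
    eval x (imp φ ψ) = 1 ↔ (eval x φ : ℝ) ≤ eval x ψ := by
  rw [Subtype.ext_iff]
  simp only [eval, coe_oplus_I, coe_star_I, Set.Icc.coe_one, min_eq_left_iff]
  constructor <;> intro h <;> linarith

theorem eval_R1 (x : Fin n → I) (r : I) (φ ψ : Form n) :
    (eval x (nabla r (imp φ ψ)) : ℝ) = eval x (imp (nabla r φ) (nabla r ψ)) := by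
  simp only [eval, coe_oplus_I, coe_star_I, coe_scal_I]
  generalize (eval x φ : ℝ) = a
  generalize (eval x ψ : ℝ) = b
  have h₀ := r.2.1
  rcases le_total a b with h | h
  · have := mul_le_mul_of_nonneg_left h h₀
    rw [min_eq_left (by linarith), min_eq_left (by linarith)]
    ring
  · have := mul_le_mul_of_nonneg_left h h₀
    rw [min_eq_right (by linarith), min_eq_right (by linarith)]
    ring

theorem eval_R2 (x : Fin n → I) (r q : I) (φ : Form n) :
    (eval x (nabla (odot r (mvStar q)) φ) : ℝ) = eval x (imp (nabla q φ) (nabla r φ)) := by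
  have h := (eval x φ).2.2
  simp only [odot, eval, coe_oplus_I, coe_star_I, coe_scal_I]
  generalize (eval x φ : ℝ) = a at *
  rcases le_total (r : ℝ) q with h' | h'
  · have := mul_le_mul_of_nonneg_right h' (sub_nonneg.2 h)
    rw [min_eq_left (by linarith), min_eq_left (by linarith)]
    ring
  · have := mul_le_mul_of_nonneg_right h' (sub_nonneg.2 h)
    rw [min_eq_right (by linarith), min_eq_right (by linarith)]
    ring

theorem eval_R3 (x : Fin n → I) (r q : I) (φ : Form n) :
    (eval x (nabla r (nabla q φ)) : ℝ) = eval x (nabla (r * q) φ) := by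
  simp only [eval, coe_star_I, coe_scal_I, Set.Icc.coe_mul]
  ring

theorem eval_R4 (x : Fin n → I) (φ : Form n) : (eval x (nabla 1 φ) : ℝ) = eval x φ := by
  simp only [eval, coe_star_I, coe_scal_I, Set.Icc.coe_one]
  ring

theorem sound (h : Provable φ) (x : Fin n → I) : eval x φ = 1 := by
  induction h with
  | mp h₁ h₂ ih₁ ih₂ =>
    rw [eval_imp_eq_one, ih₂] at ih₁
    exact le_antisymm (Subtype.coe_le_coe.1 (eval x _).2.2) (Subtype.coe_le_coe.1 ih₁)
  | L1 φ ψ =>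
    rw [eval_imp_eq_one]
    have a := (eval x φ).2
    have b := (eval x ψ).2
    simp only [eval, coe_oplus_I, coe_star_I]
    exact le_min a.2 (by linarith [b.2])
  | L2 φ ψ χ =>
    rw [eval_imp_eq_one]
    have a := (eval x φ).2
    have b := (eval x ψ).2
    have c := (eval x χ).2
    simp only [eval, coe_oplus_I, coe_star_I]
    grind
  | L3 φ ψ =>
    rw [eval_imp_eq_one]
    have a := (eval x φ).2
    have b := (eval x ψ).2
    simp only [eval, coe_oplus_I, coe_star_I]
    grind
  | L4 φ ψ =>
    rw [eval_imp_eq_one]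
    have a := (eval x φ).2
    have b := (eval x ψ).2
    simp only [eval, coe_oplus_I, coe_star_I]
    grind
  | R1 r φ ψ => exact eval_imp_eq_one.2 (eval_R1 x r φ ψ).le
  | R1' r φ ψ => exact eval_imp_eq_one.2 (eval_R1 x r φ ψ).ge
  | R2 r q φ => exact eval_imp_eq_one.2 (eval_R2 x r q φ).le
  | R2' r q φ => exact eval_imp_eq_one.2 (eval_R2 x r q φ).ge
  | R3 r q φ => exact eval_imp_eq_one.2 (eval_R3 x r q φ).le
  | R3' r q φ => exact eval_imp_eq_one.2 (eval_R3 x r q φ).ge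
  | R4 φ => exact eval_imp_eq_one.2 (eval_R4 x φ).le
  | R4' φ => exact eval_imp_eq_one.2 (eval_R4 x φ).ge

theorem trans (h₁ : Provable (imp φ ψ)) (h₂ : Provable (imp ψ χ)) : Provable (imp φ χ) :=
  ((L2 _ _ _).mp h₁).mp h₂

theorem assertion (φ ψ : Form n) : Provable (imp φ (imp (imp φ ψ) ψ)) :=
  (L1 _ (imp ψ φ)).trans (L3 _ _)

theorem exchange (h : Provable (imp φ (imp ψ χ))) : Provable (imp ψ (imp φ χ)) :=
  (assertion ψ χ).trans ((L2 _ _ _).mp h)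

theorem refl (φ : Form n) : Provable (imp φ φ) :=
  (exchange (L1 φ (imp φ (imp φ φ)))).mp (L1 φ φ)

theorem imp_congr (h₁ : Provable (imp φ' φ)) (h₂ : Provable (imp ψ ψ')) :
    Provable (imp (imp φ ψ) (imp φ' ψ')) :=
  ((L2 _ _ _).mp h₁).trans ((exchange (L2 φ' ψ ψ')).mp h₂)

theorem not_not (φ : Form n) : Provable (imp (neg (neg φ)) φ) :=
  (((L1 _ (neg (neg (imp φ φ)))).trans (L4 _ _)).trans (L4 _ _)).trans
    ((assertion (imp φ φ) φ).mp (refl φ))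

theorem not_not' (φ : Form n) : Provable (imp φ (neg (neg φ))) := (L4 _ _).mp (not_not _)

theorem neg_congr (h : Provable (imp φ ψ)) : Provable (imp (neg ψ) (neg φ)) :=
  (L4 _ _).mp (((not_not φ).trans h).trans (not_not' ψ))

theorem nabla_zero (φ : Form n) (r : I) : Provable (nabla (odot r (mvStar r)) φ) :=
  (R2' r r φ).mp (refl _)

theorem nec (h : Provable φ) (r : I) : Provable (nabla r φ) := by
  have e : odot r (mvStar 1) = odot r (mvStar r) := by
    apply Subtype.ext
    have h₀ := r.2.1
    have h₁ := r.2.2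
    simp only [odot, coe_star_I, coe_oplus_I, Set.Icc.coe_one]
    grind
  have h₂ : Provable (imp (nabla 1 φ) (nabla r φ)) :=
    (R2 r 1 φ).mp (e ▸ nabla_zero φ r)
  exact h₂.mp ((R4' φ).mp h)

theorem nabla_congr (h : Provable (imp φ ψ)) (r : I) :
    Provable (imp (nabla r φ) (nabla r ψ)) := (R1 r φ ψ).mp (h.nec r)

end Provable

/-! ### The Lindenbaum–Tarski algebra -/

/-- Provable equivalence. -/
def formSetoid (n : ℕ) : Setoid (Form n) where
  r φ ψ := Provable (imp φ ψ) ∧ Provable (imp ψ φ)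
  iseqv := ⟨fun φ => ⟨.refl φ, .refl φ⟩, fun h => ⟨h.2, h.1⟩,
    fun h₁ h₂ => ⟨h₁.1.trans h₂.1, h₂.2.trans h₁.2⟩⟩

/-- The Lindenbaum–Tarski algebra `RL_n` of formulas in `n` variables. -/
def RL (n : ℕ) : Type := Quotient (formSetoid n)

namespace RL

variable {n : ℕ}

/-- The class `[φ]`. -/
def mk (φ : Form n) : RL n := Quotient.mk (formSetoid n) φ

/-- `0 = [¬(v_0 → v_0)]`, `[φ]* = [¬φ]`, `[φ] ⊕ [ψ] = [¬φ → ψ]`, `r[φ] = [Δ_r φ]`. There has to be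
a variable, since there is no formula without variables. -/
instance [NeZero n] : RieszMVOps (RL n) where
  zero := mk (neg (imp (var 0) (var 0)))
  mvStar := Quotient.map' neg fun _ _ h => ⟨h.2.neg_congr, h.1.neg_congr⟩
  oplus := Quotient.map₂ (fun φ ψ => imp (neg φ) ψ) fun _ _ h₁ _ _ h₂ =>
    ⟨.imp_congr h₁.1.neg_congr h₂.1, .imp_congr h₁.2.neg_congr h₂.2⟩
  scal r := Quotient.map' (delta r) fun _ _ h =>
    ⟨(h.1.neg_congr.nabla_congr r).neg_congr, (h.2.neg_congr.nabla_congr r).neg_congr⟩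

/-- The term function of a class of formulas. -/
def termFun : RL n → C(Fin n → I, I) :=
  Quotient.lift Form.termFun fun φ ψ h => by
    ext x
    exact le_antisymm (Provable.eval_imp_eq_one.1 (h.1.sound x))
      (Provable.eval_imp_eq_one.1 (h.2.sound x))

/-- `‖[φ]‖_u = sup {f_φ(x) | x ∈ [0,1]^n}`. -/
def unitNorm (a : RL n) : ℝ := ⨆ x, (termFun a x : ℝ)

@[simp] theorem termFun_mk (φ : Form n) : termFun (mk φ) = φ.termFun := rfl

variable [NeZero n]

theorem termFun_zero : termFun (zero : RL n) = zero := by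
  change Form.termFun (neg (imp (var 0) (var 0))) = zero
  ext x
  change ((mvStar (oplus (mvStar (x 0)) (x 0)) : I) : ℝ) = 0
  simp

theorem termFun_star (a : RL n) : termFun (mvStar a) = mvStar (termFun a) := by
  induction a using Quotient.ind
  rfl

theorem termFun_oplus (a b : RL n) : termFun (oplus a b) = oplus (termFun a) (termFun b) := by
  induction a using Quotient.ind with | _ φ
  induction b using Quotient.ind with | _ ψ
  ext x
  change ((oplus (mvStar (mvStar (eval x φ))) (eval x ψ) : I) : ℝ) =
    ((oplus (eval x φ) (eval x ψ) : I) : ℝ)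
  simp

theorem termFun_scal (r : I) (a : RL n) : termFun (scal r a) = scal r (termFun a) := by
  induction a using Quotient.ind with | _ φ
  ext x
  change ((mvStar (mvStar (scal r (mvStar (mvStar (eval x φ))))) : I) : ℝ) =
    ((scal r (eval x φ) : I) : ℝ)
  simp

theorem termFun_changDist (a b : RL n) (x : Fin n → I) :
    (termFun (changDist a b) x : ℝ) = |(termFun a x : ℝ) - termFun b x| := by
  simp only [changDist, odot, termFun_oplus, termFun_star]
  change ((changDist (termFun a x) (termFun b x) : I) : ℝ) = _
  simp only [changDist, odot, coe_oplus_I, coe_star_I]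
  have h₁ := (termFun a x).2
  have h₂ := (termFun b x).2
  obtain ⟨_, _⟩ := h₁
  obtain ⟨_, _⟩ := h₂
  grind

theorem unitNorm_changDist (a b : RL n) :
    unitNorm (changDist a b) = dist (termFun a) (termFun b) := by
  rw [unitNorm, ContinuousMap.dist_eq_iSup]
  exact iSup_congr fun x => termFun_changDist a b x

/-- `RL_n` with the distance `‖d([φ],[ψ])‖_u`. -/
instance : PseudoMetricSpace (RL n) where
  dist a b := unitNorm (changDist a b)
  dist_self a := by rw [unitNorm_changDist, dist_self]
  dist_comm a b := by rw [unitNorm_changDist, unitNorm_changDist, dist_comm]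
  dist_triangle a b c := by simpa only [unitNorm_changDist] using dist_triangle _ _ _

theorem isometry_termFun : Isometry (termFun : RL n → C(Fin n → I, I)) :=
  Isometry.of_dist_eq fun a b => (unitNorm_changDist a b).symm

theorem dist_le_of_termFun {a b : RL n} {C : ℝ} (hC : 0 ≤ C)
    (h : ∀ x, |(termFun a x : ℝ) - termFun b x| ≤ C) : dist a b ≤ C := by
  rw [← isometry_termFun.dist_eq]
  exact (ContinuousMap.dist_le hC).2 h

theorem termFun_le_dist (a b : RL n) (x : Fin n → I) :
    |(termFun a x : ℝ) - termFun b x| ≤ dist a b := by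
  rw [← isometry_termFun.dist_eq]
  exact ContinuousMap.dist_apply_le_dist (f := termFun a) (g := termFun b) x

theorem uniformContinuous_star : UniformContinuous (mvStar : RL n → RL n) :=
  (LipschitzWith.of_dist_le_mul (K := 1) fun (a b : RL n) => by
    rw [NNReal.coe_one, one_mul]
    refine dist_le_of_termFun dist_nonneg fun x => ?_
    have h := termFun_le_dist a b x
    rw [termFun_star, termFun_star]
    change |(1 - (termFun a x : ℝ)) - (1 - termFun b x)| ≤ _
    rw [abs_le] at *
    constructor <;> linarith).uniformContinuous

theorem uniformContinuous_scal (r : I) : UniformContinuous (scal r : RL n → RL n) :=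
  (LipschitzWith.of_dist_le_mul (K := 1) fun (a b : RL n) => by
    rw [NNReal.coe_one, one_mul]
    refine dist_le_of_termFun dist_nonneg fun x => ?_
    have h := termFun_le_dist a b x
    rw [termFun_scal, termFun_scal]
    change |(r : ℝ) * (termFun a x : ℝ) - r * termFun b x| ≤ _
    rw [← mul_sub, abs_mul, abs_of_nonneg r.2.1]
    exact (mul_le_of_le_one_left (abs_nonneg _) r.2.2).trans h).uniformContinuous

theorem lipschitzWith_oplus (a : RL n) : LipschitzWith 1 fun b : RL n => oplus a b :=
  LipschitzWith.of_dist_le_mul fun b c => by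
    rw [NNReal.coe_one, one_mul]
    refine dist_le_of_termFun dist_nonneg fun x => ?_
    have h := termFun_le_dist b c x
    rw [termFun_oplus, termFun_oplus]
    change |min 1 ((termFun a x : ℝ) + termFun b x) - min 1 ((termFun a x : ℝ) + termFun c x)| ≤ _
    refine (abs_min_sub_min_le_max _ _ _ _).trans ?_
    simpa using h

theorem lipschitzWith_oplus' (b : RL n) : LipschitzWith 1 fun a : RL n => oplus a b :=
  LipschitzWith.of_dist_le_mul fun a c => by
    rw [NNReal.coe_one, one_mul]
    refine dist_le_of_termFun dist_nonneg fun x => ?_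
    have h := termFun_le_dist a c x
    rw [termFun_oplus, termFun_oplus]
    change |min 1 ((termFun a x : ℝ) + termFun b x) - min 1 ((termFun c x : ℝ) + termFun b x)| ≤ _
    refine (abs_min_sub_min_le_max _ _ _ _).trans ?_
    simpa using h

theorem uniformContinuous_oplus : UniformContinuous₂ (oplus : RL n → RL n → RL n) :=
  (LipschitzWith.uncurry (f := (oplus : RL n → RL n → RL n)) lipschitzWith_oplus'
    lipschitzWith_oplus).uniformContinuous

theorem unitNorm_eq_dist (a : RL n) : unitNorm a = dist a zero := by
  change _ = unitNorm (changDist a zero)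
  refine iSup_congr fun x => ?_
  rw [termFun_changDist, termFun_zero]
  change _ = |(termFun a x : ℝ) - 0|
  rw [sub_zero, abs_of_nonneg (termFun a x).2.1]

theorem uniformContinuous_unitNorm : UniformContinuous (unitNorm : RL n → ℝ) := by
  rw [show (unitNorm : RL n → ℝ) = fun a => dist a zero from funext unitNorm_eq_dist]
  exact uniformContinuous_id.dist uniformContinuous_const

/-! ### The norm-completion -/

/-- The norm-completion of `(RL_n, ‖·‖_u)`. -/
abbrev NormCompletion (n : ℕ) [NeZero n] : Type := Completion (RL n)

/-- The operations of `RL_n`, extended to the completion by continuity. -/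
instance : RieszMVOps (NormCompletion n) where
  zero := ((zero : RL n) : Completion (RL n))
  mvStar := Completion.map mvStar
  oplus := Completion.map₂ oplus
  scal r := Completion.map (scal r)

/-- The norm of `RL_n`, extended to the completion by continuity. -/
def completionNorm : NormCompletion n → ℝ := Completion.extension unitNorm

theorem coe_star (a : RL n) :
    (mvStar (a : NormCompletion n)) = ((mvStar a : RL n) : NormCompletion n) :=
  Completion.map_coe uniformContinuous_star a

theorem coe_oplus (a b : RL n) :
    oplus (a : NormCompletion n) (b : NormCompletion n) = ((oplus a b : RL n) : NormCompletion n) :=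
  Completion.map₂_coe_coe a b _ uniformContinuous_oplus

theorem coe_scal (r : I) (a : RL n) :
    scal r (a : NormCompletion n) = ((scal r a : RL n) : NormCompletion n) :=
  Completion.map_coe (uniformContinuous_scal r) a

theorem completionNorm_coe (a : RL n) : completionNorm (a : NormCompletion n) = unitNorm a :=
  Completion.extension_coe uniformContinuous_unitNorm a

end RL
end RieszLuk

end

open RieszLuk RieszMVOps

/-! The crux of (1) is completeness: a formula with term function `1` is a theorem, so `termFun` is
injective on `RL n`. Suppose `ψ` is not provable. By Zorn there is a theory `T` maximal among those
omitting `ψ`, and prelinearity makes its algebra a chain in which `ψ` is not `0` (truth is `0` in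
the dual order). This chain may contain infinitesimals, so it need not embed in `[0,1]`; but only
the finite set `S` of classes of subformulas of `ψ`, with `0` and `1`, has to be realized.

For that, real linear combinations of elements of `S` are preordered: `p - q` is positive if `ε q ≤
ε p` in the chain for all small `ε > 0`. Scaling by `ε` keeps the sums that must be cancelled below
truncation. The combinations that are both positive and negative form a subspace. The finitely many
differences `eᵢ - eⱼ` with `aⱼ < aᵢ` have a compact convex hull that misses it, so Hahn–Banach gives
a functional that kills the subspace and is strictly positive on these differences. Normalized at
`1`, it is a valuation giving `ψ` a value below `1` (`RieszBCK.exists_realization`,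
`Provable.of_eval_eq_one`).

Parts (2) and (3) rest on density. The multiples of differences of term functions form a vector
lattice that interpolates at any two points, so it is dense by Stone–Weierstrass; the truncation of
each of its members to `[0,1]` is again a term function. Hence `termFun` is an isometry with dense
range into a complete space and extends to the completion. -/

noncomputable section
namespace RieszLuk

/-- Bounded commutative BCK-algebras with scalars in `[0,1]`: the order duals of Riesz MV-algebras,
with truncated subtraction as the basic operation. -/
class RieszBCK (A : Type*) extends Zero A, One A, Sub A, SMul I A where
  sub_right_comm' : ∀ x y z : A, x - y - z = x - z - y
  inf_comm' : ∀ x y : A, x - (x - y) = y - (y - x)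
  sub_self' : ∀ x : A, x - x = 0
  sub_zero' : ∀ x : A, x - 0 = x
  zero_sub' : ∀ x : A, 0 - x = 0
  sub_one' : ∀ x : A, x - 1 = 0
  sub_sub_sub' : ∀ x y z : A, (x - y) - (x - z) - (z - y) = 0
  smul_sub' : ∀ (r : I) (x y : A), r • (x - y) = r • x - r • y
  sub_smul' : ∀ (r q : I) (x : A), odot r (RieszMVOps.mvStar q) • x = r • x - q • x
  mul_smul' : ∀ (r q : I) (x : A), (r * q) • x = r • q • x
  one_smul' : ∀ x : A, (1 : I) • x = x

/-! ### Order and truncated addition in the dual algebra. -/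

namespace RieszBCK

variable {A : Type*} [RieszBCK A]


instance : PartialOrder A where
  le x y := x - y = 0
  le_refl := sub_self'
  le_trans x y z h₁ h₂ := by
    have := sub_sub_sub' x z y
    change x - y = 0 at h₁
    change y - z = 0 at h₂
    change x - z = 0
    rwa [h₁, h₂, sub_zero', sub_zero'] at this
  le_antisymm x y h₁ h₂ := by
    have := inf_comm' x y
    change x - y = 0 at h₁
    change y - x = 0 at h₂
    rwa [h₁, h₂, sub_zero', sub_zero'] at this

theorem le_iff {x y : A} : x ≤ y ↔ x - y = 0 := Iff.rfl

theorem sub_le_sub_left' {x y : A} (h : x ≤ y) (z : A) : z - y ≤ z - x := by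
  have := sub_sub_sub' z y x
  rwa [le_iff.1 h, sub_zero'] at this

theorem sub_le_sub_right' {x y : A} (h : x ≤ y) (z : A) : x - z ≤ y - z := by
  have := sub_sub_sub' x z y
  rwa [le_iff.1 h, sub_zero'] at this

theorem le_one' (x : A) : x ≤ 1 := sub_one' x

theorem zero_le' (x : A) : 0 ≤ x := zero_sub' x

theorem sub_le' (x y : A) : x - y ≤ x := by
  simpa only [sub_zero'] using sub_le_sub_left' (zero_le' y) x

theorem sub_sub_of_le {x y : A} (h : x ≤ y) : y - (y - x) = x := by
  rw [inf_comm', le_iff.1 h, sub_zero']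

theorem eq_zero_of_le {x : A} (h : x ≤ 0) : x = 0 := le_antisymm h (zero_le' x)

theorem one_sub_one_sub (x : A) : 1 - (1 - x) = x := sub_sub_of_le (le_one' x)

instance : Add A := ⟨fun x y => 1 - (1 - x - y)⟩

theorem add_def (x y : A) : x + y = 1 - (1 - x - y) := rfl

instance : AddCommMonoid A where
  add_assoc x y z := by
    simp only [add_def]
    rw [one_sub_one_sub, sub_right_comm' 1 x (1 - _), one_sub_one_sub, sub_right_comm' 1 x y,
      sub_right_comm' (1 - y) x z]
  add_comm x y := by
    rw [add_def, add_def, sub_right_comm']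
  zero_add x := by
    rw [add_def, sub_zero', one_sub_one_sub]
  add_zero x := by
    rw [add_def, sub_zero', one_sub_one_sub]
  nsmul := nsmulRec

/-- The hypothesis says that the sum is not truncated. It is the side condition of every
cancellation below. -/
theorem add_sub_of_le {x y : A} (h : x ≤ 1 - y) : x + y - y = x := by
  rw [add_def, sub_right_comm' 1 x, sub_right_comm', sub_sub_of_le h]

theorem sub_add_of_le {x y : A} (h : y ≤ x) : x - y + y = x := by
  have e : x - y = 1 - y - (1 - x) := by
    rw [sub_right_comm', one_sub_one_sub]
  rw [add_def, sub_right_comm', e, sub_sub_of_le (sub_le_sub_left' h 1), one_sub_one_sub]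

theorem add_le_add_left' {x y : A} (h : x ≤ y) (z : A) : x + z ≤ y + z :=
  sub_le_sub_left' (sub_le_sub_right' (sub_le_sub_left' h 1) z) 1

theorem add_le_add' {x y z w : A} (h : x ≤ y) (h' : z ≤ w) : x + z ≤ y + w := by
  refine (add_le_add_left' h z).trans ?_
  rw [add_comm y, add_comm y]
  exact add_le_add_left' h' y

theorem le_of_add_le_add {x y z : A} (hx : x ≤ 1 - z) (hy : y ≤ 1 - z) (h : x + z ≤ y + z) :
    x ≤ y := by
  rw [← add_sub_of_le hx, ← add_sub_of_le hy]
  exact sub_le_sub_right' h z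

/-! ### Scalars -/

/-- Multiplication by a real number, truncated to `[0,1]`. -/
def rsmul (r : ℝ) (x : A) : A := Set.projIcc (0 : ℝ) 1 zero_le_one r • x

theorem odot_star_coe (r q : I) :
    ((odot r (RieszMVOps.mvStar q) : I) : ℝ) = max 0 ((r : ℝ) - q) := by
  have := r.2.1; have := r.2.2; have := q.2.1; have := q.2.2
  simp only [odot, coe_star_I, coe_oplus_I]
  grind

theorem smul_le_smul_right {r q : I} (h : r ≤ q) (x : A) : r • x ≤ q • x := by
  -- Both scalars are `0`, so `sub_smul'` turns `r • x - q • x` into `r • x - r • x`.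
  have e : odot r (RieszMVOps.mvStar q) = odot r (RieszMVOps.mvStar r) := by
    apply Subtype.ext
    rw [odot_star_coe, odot_star_coe, max_eq_left (sub_nonpos.2 (Subtype.coe_le_coe.2 h)),
      sub_self, max_self]
  rw [le_iff, ← sub_smul', e, sub_smul', sub_self']

theorem zero_smul' (x : A) : (0 : I) • x = 0 := by
  have e : (0 : I) = odot 0 (RieszMVOps.mvStar 0) := by
    apply Subtype.ext
    rw [odot_star_coe]
    simp
  rw [e, sub_smul', sub_self']

theorem smul_mono (r : I) {x y : A} (h : x ≤ y) : r • x ≤ r • y := by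
  rw [le_iff, ← smul_sub', le_iff.1 h, ← sub_self' (0 : A), smul_sub', sub_self', sub_self']

theorem rsmul_of_mem {r : ℝ} (h : r ∈ I) (x : A) : rsmul r x = (⟨r, h⟩ : I) • x := by
  rw [rsmul, Set.projIcc_of_mem zero_le_one h]

theorem rsmul_zero_left (x : A) : rsmul 0 x = 0 := by
  rw [rsmul_of_mem ⟨le_rfl, zero_le_one⟩]
  exact zero_smul' x

theorem rsmul_one (x : A) : rsmul 1 x = x := by
  rw [rsmul_of_mem ⟨zero_le_one, le_rfl⟩]
  exact one_smul' x

theorem rsmul_mono (r : ℝ) {x y : A} (h : x ≤ y) : rsmul r x ≤ rsmul r y := smul_mono _ h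

theorem rsmul_mono_left {r q : ℝ} (h : r ≤ q) (x : A) : rsmul r x ≤ rsmul q x :=
  smul_le_smul_right (Set.monotone_projIcc _ h) x

theorem rsmul_sub (r : ℝ) (x y : A) : rsmul r (x - y) = rsmul r x - rsmul r y := smul_sub' _ _ _

theorem rsmul_smul {r : ℝ} (hr : r ∈ I) (q : I) (x : A) : rsmul r (q • x) = rsmul (r * q) x := by
  rw [rsmul_of_mem hr, rsmul_of_mem ⟨mul_nonneg hr.1 q.2.1, mul_le_one₀ hr.2 q.2.1 q.2.2⟩,
    ← mul_smul']
  rfl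

theorem sub_rsmul {r q : ℝ} (hr : r ∈ I) (hq : q ∈ I) (h : q ≤ r) (x : A) :
    rsmul (r - q) x = rsmul r x - rsmul q x := by
  have h' : r - q ∈ I := ⟨sub_nonneg.2 h, by linarith [hr.2, hq.1]⟩
  rw [rsmul_of_mem hr, rsmul_of_mem hq, rsmul_of_mem h', ← sub_smul']
  congr 1
  apply Subtype.ext
  rw [odot_star_coe, max_eq_right (sub_nonneg.2 h)]

theorem add_rsmul {r q : ℝ} (hr : 0 ≤ r) (hq : 0 ≤ q) (h : r + q ≤ 1) (x : A) :
    rsmul (r + q) x = rsmul r x + rsmul q x := by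
  have e := sub_rsmul (r := r + q) (q := q) ⟨by linarith, h⟩ ⟨hq, by linarith⟩ (by linarith) x
  rw [add_sub_cancel_right] at e
  rw [e, sub_add_of_le (rsmul_mono_left (by linarith) x)]

theorem rsmul_le_one_sub {r q : ℝ} (hr : 0 ≤ r) (hq : 0 ≤ q) (h : r + q ≤ 1) {x y : A}
    (hx : x ≤ rsmul r 1) (hy : y ≤ rsmul q 1) : x ≤ 1 - y := by
  refine (hx.trans ?_).trans (sub_le_sub_left' hy 1)
  have e := sub_rsmul (r := 1) (q := q) ⟨zero_le_one, le_rfl⟩ ⟨hq, by linarith⟩ (by linarith) (1 : A)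
  rw [rsmul_one] at e
  rw [← e]
  exact rsmul_mono_left (by linarith) 1

/-- Once `1/(m+1) < r`, the element `x` is a sum of `m+1` copies of `rsmul (1/(m+1)) x`, and each
copy lies below `rsmul r x = 0`. -/
theorem eq_zero_of_rsmul {r : ℝ} (hr : 0 < r) {x : A} (h : rsmul r x = 0) : x = 0 := by
  obtain ⟨m, hm⟩ := exists_nat_one_div_lt hr
  have hm₀ : (0 : ℝ) < m + 1 := by positivity
  have key : ∀ k : ℕ, (k : ℝ) ≤ m + 1 → rsmul (k / ((m : ℝ) + 1)) x = 0 := by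
    intro k
    induction k with
    | zero => intro _; rw [Nat.cast_zero, zero_div, rsmul_zero_left]
    | succ k ih =>
      intro hk
      push_cast at hk ⊢
      rw [add_div, add_rsmul (by positivity) (by positivity)
        (by rw [← add_div, div_le_one hm₀]; exact hk), ih (by linarith), zero_add]
      exact eq_zero_of_le (h ▸ rsmul_mono_left hm.le x)
  have := key (m + 1) (by push_cast; rfl)
  push_cast at this
  rwa [div_self hm₀.ne', rsmul_one] at this

theorem le_of_rsmul_le {r : ℝ} (hr : 0 < r) {x y : A} (h : rsmul r x ≤ rsmul r y) : x ≤ y := by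
  rw [le_iff]
  exact eq_zero_of_rsmul hr (by rw [rsmul_sub, le_iff.1 h])

/-! ### Formal linear combinations -/

section LinComb

variable {ι : Type*} [Fintype ι] (a : ι → A)

/-- The element `∑ cᵢ aᵢ`, meaningful for small nonnegative coefficients. -/
def linComb (c : ι → ℝ) : A := ∑ i, rsmul (c i) (a i)

/-- Truncated addition is associative and commutative, so a bound on each coefficient suffices; the
total may well exceed `1`. -/
theorem linComb_add {c d : ι → ℝ} (hc : 0 ≤ c) (hd : 0 ≤ d) (h : ∀ i, c i + d i ≤ 1) :
    linComb a (c + d) = linComb a c + linComb a d := by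
  rw [linComb, linComb, linComb, ← Finset.sum_add_distrib]
  exact Finset.sum_congr rfl fun i _ => add_rsmul (hc i) (hd i) (h i) _

theorem linComb_single [DecidableEq ι] (i : ι) (r : ℝ) :
    linComb a (Pi.single i r) = rsmul r (a i) := by
  rw [linComb, Finset.sum_eq_single i]
  · rw [Pi.single_eq_same]
  · intro j _ h
    rw [Pi.single_eq_of_ne h, rsmul_zero_left]
  · simp

/-- Bounds a combination by a multiple of `1`, which is how small combinations are seen not to
truncate. -/
theorem linComb_le {c : ι → ℝ} (hc : 0 ≤ c) (h : ∑ i, c i ≤ 1) :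
    linComb a c ≤ rsmul (∑ i, c i) 1 := by
  classical
  have key : ∀ s : Finset ι, ∑ i ∈ s, c i ≤ 1 →
      ∑ i ∈ s, rsmul (c i) (a i) ≤ rsmul (∑ i ∈ s, c i) 1 := by
    intro s
    induction s using Finset.induction_on with
    | empty => intro _; exact zero_le' _
    | insert i s hi ih =>
      intro hs
      rw [Finset.sum_insert hi] at hs ⊢
      rw [Finset.sum_insert hi]
      have h₀ : 0 ≤ ∑ i ∈ s, c i := Finset.sum_nonneg fun i _ => hc i
      have h₁ : 0 ≤ c i := hc i
      rw [add_rsmul h₁ h₀ hs]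
      exact add_le_add' (rsmul_mono _ (le_one' _)) (ih (by linarith))
  exact key Finset.univ h

/-- The formal linear combinations with nonnegative value. -/
def posCone : Set (ι → ℝ) :=
  {c | ∃ p q : ι → ℝ, 0 ≤ p ∧ 0 ≤ q ∧ c = p - q ∧
    ∃ δ : ℝ, 0 < δ ∧ ∀ ε, 0 < ε → ε ≤ δ → linComb a (ε • q) ≤ linComb a (ε • p)}

theorem exists_small {p : ι → ℝ} (hp : 0 ≤ p) : ∃ δ : ℝ, 0 < δ ∧ ∀ ε, 0 < ε → ε ≤ δ →
    ∑ i, (ε • p) i ≤ 1 := by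
  have h₀ : 0 ≤ ∑ i, p i := Finset.sum_nonneg fun i _ => hp i
  refine ⟨1 / (∑ i, p i + 1), by positivity, fun ε hε h => ?_⟩
  rw [le_div_iff₀ (by positivity)] at h
  simp only [Pi.smul_apply, smul_eq_mul, ← Finset.mul_sum]
  nlinarith

theorem linComb_smul_add {p q : ι → ℝ} (hp : 0 ≤ p) (hq : 0 ≤ q) : ∃ δ : ℝ, 0 < δ ∧
    ∀ ε, 0 < ε → ε ≤ δ → linComb a (ε • (p + q)) = linComb a (ε • p) + linComb a (ε • q) := by
  obtain ⟨δ, hδ, h⟩ := exists_small (add_nonneg hp hq)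
  refine ⟨δ, hδ, fun ε hε hε' => ?_⟩
  rw [smul_add]
  have h₁ : 0 ≤ ε • p := smul_nonneg hε.le hp
  have h₂ : 0 ≤ ε • q := smul_nonneg hε.le hq
  refine linComb_add a h₁ h₂ fun i => ?_
  refine le_trans ?_ (h ε hε hε')
  rw [smul_add]
  exact Finset.single_le_sum (f := fun i => (ε • p + ε • q) i)
    (fun j _ => add_nonneg (h₁ j) (h₂ j)) (Finset.mem_univ i)

variable {a}

theorem posCone_add {c d : ι → ℝ} (hc : c ∈ posCone a) (hd : d ∈ posCone a) :
    c + d ∈ posCone a := by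
  obtain ⟨p, q, hp, hq, rfl, δ, hδ, h⟩ := hc
  obtain ⟨p', q', hp', hq', rfl, δ', hδ', h'⟩ := hd
  obtain ⟨η, hη, e⟩ := linComb_smul_add a hp hp'
  obtain ⟨η', hη', e'⟩ := linComb_smul_add a hq hq'
  refine ⟨p + p', q + q', add_nonneg hp hp', add_nonneg hq hq', by abel,
    min (min δ δ') (min η η'), by positivity, fun ε hε hε' => ?_⟩
  simp only [le_min_iff] at hε'
  rw [e ε hε hε'.2.1, e' ε hε hε'.2.2]
  exact add_le_add' (h ε hε hε'.1.1) (h' ε hε hε'.1.2)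

theorem posCone_smul {t : ℝ} (ht : 0 < t) {c : ι → ℝ} (hc : c ∈ posCone a) :
    t • c ∈ posCone a := by
  obtain ⟨p, q, hp, hq, rfl, δ, hδ, h⟩ := hc
  refine ⟨t • p, t • q, smul_nonneg ht.le hp, smul_nonneg ht.le hq, smul_sub _ _ _, δ / t,
    by positivity, fun ε hε hε' => ?_⟩
  rw [smul_smul, smul_smul]
  exact h _ (mul_pos hε ht) ((le_div_iff₀ ht).1 hε')

theorem zero_mem_posCone : (0 : ι → ℝ) ∈ posCone a :=
  ⟨0, 0, le_rfl, le_rfl, by simp, 1, one_pos, fun _ _ _ => le_rfl⟩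

variable (a) in
/-- The formal linear combinations with value zero. -/
def nullSpace : Submodule ℝ (ι → ℝ) where
  carrier := {c | c ∈ posCone a ∧ -c ∈ posCone a}
  add_mem' h h' := ⟨posCone_add h.1 h'.1, by rw [neg_add]; exact posCone_add h.2 h'.2⟩
  zero_mem' := ⟨zero_mem_posCone, by rw [neg_zero]; exact zero_mem_posCone⟩
  smul_mem' t c h := by
    rcases lt_trichotomy t 0 with ht | rfl | ht
    · have ht' := neg_pos.2 ht
      refine ⟨?_, ?_⟩
      · rw [← neg_smul_neg]
        exact posCone_smul ht' h.2
      · rw [← neg_smul]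
        exact posCone_smul ht' h.1
    · simpa using zero_mem_posCone
    · refine ⟨posCone_smul ht h.1, ?_⟩
      rw [← smul_neg]
      exact posCone_smul ht h.2

/-- Turns an identity between small combinations in `A` into a linear relation respected by every
functional that kills `nullSpace a`. -/
theorem mem_nullSpace_of_eq {p q : ι → ℝ} (hp : 0 ≤ p) (hq : 0 ≤ q) {δ : ℝ} (hδ : 0 < δ)
    (h : ∀ ε : ℝ, 0 < ε → ε ≤ δ → linComb a (ε • q) = linComb a (ε • p)) :
    p - q ∈ nullSpace a :=
  ⟨⟨p, q, hp, hq, rfl, δ, hδ, fun ε h₁ h₂ => (h ε h₁ h₂).le⟩,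
    ⟨q, p, hq, hp, by abel, δ, hδ, fun ε h₁ h₂ => (h ε h₁ h₂).ge⟩⟩

/-- If `-(s c + t d)` were in the cone, adding `t d` would put `-s c`, hence `-c`, there. -/
theorem convex_strictPos : Convex ℝ {c : ι → ℝ | c ∈ posCone a ∧ -c ∉ posCone a} := by
  rw [convex_iff_forall_pos]
  intro c hc d hd s t hs ht _
  refine ⟨posCone_add (posCone_smul hs hc.1) (posCone_smul ht hd.1), fun h => hc.2 ?_⟩
  have h' := posCone_smul (inv_pos.2 hs) (posCone_add h (posCone_smul ht hd.1))
  have e : s⁻¹ • (-(s • c + t • d) + t • d) = -c := by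
    rw [neg_add, neg_add_cancel_right, smul_neg, inv_smul_smul₀ hs.ne']
  rwa [e] at h'

variable [DecidableEq ι]

theorem single_sub_mem {i j : ι} (h : a j ≤ a i) :
    (Pi.single i 1 - Pi.single j 1 : ι → ℝ) ∈ posCone a := by
  refine ⟨_, _, ?_, ?_, rfl, 1, one_pos, fun ε hε _ => ?_⟩
  · exact Pi.single_nonneg.2 zero_le_one
  · exact Pi.single_nonneg.2 zero_le_one
  · rw [← Pi.single_smul, ← Pi.single_smul, linComb_single, linComb_single]
    exact rsmul_mono _ h

/-- The preorder on combinations adds no new inequality between generators. From `eᵢ + q = eⱼ + p`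
and `ε q ≤ ε p` follows `ε aⱼ + ε p = ε aᵢ + ε q ≤ ε aᵢ + ε p`; then `ε p` cancels and `ε` is
divided out. -/
theorem le_of_single_sub_mem {i j : ι}
    (h : (Pi.single i 1 - Pi.single j 1 : ι → ℝ) ∈ posCone a) : a j ≤ a i := by
  obtain ⟨p, q, hp, hq, e, δ, hδ, h⟩ := h
  have hi : (0 : ι → ℝ) ≤ Pi.single i 1 := Pi.single_nonneg.2 zero_le_one
  have hj : (0 : ι → ℝ) ≤ Pi.single j 1 := Pi.single_nonneg.2 zero_le_one
  obtain ⟨η, hη, e₁⟩ := linComb_smul_add a hi hq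
  obtain ⟨η', hη', e₂⟩ := linComb_smul_add a hj hp
  obtain ⟨κ, hκ, e₃⟩ := exists_small hp
  -- `δ` gives the cone inequality and `η`, `η'` give additivity. The bounds `1/2` and `κ/2` keep
  -- both `ε` and the total of `ε • p` at most `1/2`, so that `ε • p` can be cancelled.
  obtain ⟨ε, hε, hε'⟩ : ∃ ε : ℝ, 0 < ε ∧ ε ≤ min (min δ (1 / 2)) (min (min η η') (κ / 2)) :=
    ⟨_, by positivity, le_rfl⟩
  simp only [le_min_iff] at hε'
  obtain ⟨⟨h₁, h₂⟩, ⟨h₃, h₄⟩, h₅⟩ := hε'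
  have e' : ε • (Pi.single i 1 + q : ι → ℝ) = ε • (Pi.single j 1 + p) := by
    rw [sub_eq_sub_iff_add_eq_add.1 e, add_comm]
  have e'' := congrArg (linComb a) e'
  rw [e₁ ε hε h₃, e₂ ε hε h₄, ← Pi.single_smul, ← Pi.single_smul, linComb_single,
    linComb_single, smul_eq_mul, mul_one] at e''
  have hs : ∑ i, (ε • p) i ≤ 1 / 2 := by
    have := e₃ (2 * ε) (by linarith) (by linarith)
    rw [mul_smul] at this
    simp only [Pi.smul_apply, smul_eq_mul, ← Finset.mul_sum] at this ⊢
    linarith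
  have hs₀ : 0 ≤ ∑ i, (ε • p) i := Finset.sum_nonneg fun k _ => smul_nonneg hε.le hp k
  have hb := linComb_le a (smul_nonneg hε.le hp) (hs.trans (by norm_num))
  refine le_of_rsmul_le hε (le_of_add_le_add (z := linComb a (ε • p)) ?_ ?_ ?_)
  · exact rsmul_le_one_sub hε.le hs₀ (by linarith) (rsmul_mono _ (le_one' _)) hb
  · exact rsmul_le_one_sub hε.le hs₀ (by linarith) (rsmul_mono _ (le_one' _)) hb
  · rw [← e'']
    exact add_le_add' le_rfl (h ε hε h₁)

theorem exists_functional (a : ι → A) : ∃ L : (ι → ℝ) →ₗ[ℝ] ℝ,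
    (∀ c ∈ nullSpace a, L c = 0) ∧
    ∀ i j, a j < a i → 0 < L (Pi.single i 1 - Pi.single j 1) := by
  set V : Set (ι → ℝ) :=
    (fun x : ι × ι => Pi.single x.1 1 - Pi.single x.2 1) '' {x | a x.2 < a x.1} with hV
  have hVfin : V.Finite := (Set.toFinite _).image _
  have hVK : convexHull ℝ V ⊆ {c : ι → ℝ | c ∈ posCone a ∧ -c ∉ posCone a} := by
    refine convexHull_min ?_ convex_strictPos
    rintro _ ⟨⟨i, j⟩, hij, rfl⟩
    refine ⟨single_sub_mem (le_of_lt hij), fun h => ?_⟩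
    rw [neg_sub] at h
    exact not_le_of_gt hij (le_of_single_sub_mem h)
  obtain ⟨f, u, v, hu, huv, hv⟩ := geometric_hahn_banach_compact_closed
    (convex_convexHull ℝ V) (hVfin.isCompact_convexHull ℝ) (nullSpace a).convex
    (nullSpace a).closed_of_finiteDimensional
    (Set.disjoint_left.2 fun c hc hn => (hVK hc).2 hn.2)
  have hv₀ : v < 0 := by simpa using hv (0 : ι → ℝ) (nullSpace a).zero_mem
  refine ⟨-(f : (ι → ℝ) →ₗ[ℝ] ℝ), fun c hc => ?_, fun i j hij => ?_⟩
  -- A functional bounded below on a subspace vanishes there: otherwise a multiple of `c` attains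
  -- the excluded value `v`.
  · by_contra hne
    have hne' : f c ≠ 0 := fun h => hne (by simp [h])
    have := hv ((v / f c) • c) ((nullSpace a).smul_mem _ hc)
    rw [map_smul, smul_eq_mul, div_mul_cancel₀ _ hne'] at this
    exact lt_irrefl _ this
  · have := hu _ (subset_convexHull ℝ V ⟨(i, j), hij, rfl⟩)
    change 0 < -(f _)
    linarith

end LinComb

/-- A finite part of a chain embeds into `[0,1]`. -/
theorem exists_realization (htot : ∀ x y : A, x ≤ y ∨ y ≤ x) (h01 : (0 : A) ≠ 1) (S : Finset A)
    (h0 : 0 ∈ S) (h1 : 1 ∈ S) : ∃ l : A → ℝ, l 0 = 0 ∧ l 1 = 1 ∧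
      (∀ x ∈ S, ∀ y ∈ S, x < y → l x < l y) ∧
      (∀ x ∈ S, ∀ y ∈ S, x - y ∈ S → l (x - y) = max 0 (l x - l y)) ∧
      (∀ (r : I), ∀ x ∈ S, r • x ∈ S → l (r • x) = r * l x) ∧ ∀ x, l x ∈ I := by
  classical
  obtain ⟨L, hN, hL⟩ := exists_functional (fun x : S => (x : A))
  -- The default `0` off `S` keeps the final `l` in `[0,1]` everywhere, so it also evaluates
  -- variables that do not occur in the formula.
  set m : A → ℝ := fun x => if h : x ∈ S then L (Pi.single ⟨x, h⟩ 1) else 0 with hm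
  have hmS : ∀ x (h : x ∈ S), m x = L (Pi.single ⟨x, h⟩ 1) := fun x h => dif_pos h
  have hlt : ∀ x ∈ S, ∀ y ∈ S, x < y → m x < m y := by
    intro x hx y hy h
    have := hL ⟨y, hy⟩ ⟨x, hx⟩ h
    rw [map_sub] at this
    rw [hmS x hx, hmS y hy]
    linarith
  have hle : ∀ x ∈ S, ∀ y ∈ S, x ≤ y → m x ≤ m y := fun x hx y hy h =>
    h.eq_or_lt.elim (fun e => e ▸ le_rfl) fun h => (hlt x hx y hy h).le
  have hz : ∀ s : S, (0 : S → ℝ) ≤ Pi.single s 1 := fun s => Pi.single_nonneg.2 zero_le_one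
  have hsmul : ∀ (r : I), ∀ x ∈ S, r • x ∈ S → m (r • x) = r * m x := by
    intro r x hx hrx
    have := hN _ (mem_nullSpace_of_eq (a := fun x : S => (x : A)) (hz ⟨r • x, hrx⟩)
      (smul_nonneg r.2.1 (hz ⟨x, hx⟩)) one_pos fun ε hε hε' => by
        rw [← Pi.single_smul, ← Pi.single_smul, ← Pi.single_smul, linComb_single,
          linComb_single]
        simp only [smul_eq_mul, mul_one]
        rw [rsmul_smul ⟨hε.le, hε'⟩])
    rw [map_sub, map_smul, smul_eq_mul] at this
    rw [hmS x hx, hmS _ hrx]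
    linarith
  have h0m : m 0 = 0 := by
    have := hsmul 0 0 h0 (by rwa [zero_smul'])
    rwa [zero_smul', Set.Icc.coe_zero, zero_mul] at this
  have hsub' : ∀ x ∈ S, ∀ y ∈ S, x - y ∈ S → y ≤ x → m (x - y) = m x - m y := by
    intro x hx y hy hxy h
    obtain ⟨δ, hδ, e⟩ := linComb_smul_add (fun x : S => (x : A)) (hz ⟨x - y, hxy⟩) (hz ⟨y, hy⟩)
    have := hN _ (mem_nullSpace_of_eq (hz ⟨x, hx⟩) (add_nonneg (hz ⟨x - y, hxy⟩) (hz ⟨y, hy⟩))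
        hδ fun ε hε hε' => by
      rw [e ε hε hε', ← Pi.single_smul, ← Pi.single_smul, ← Pi.single_smul, linComb_single,
        linComb_single, linComb_single, smul_eq_mul, mul_one, rsmul_sub,
        sub_add_of_le (rsmul_mono _ h)])
    rw [map_sub, map_add] at this
    rw [hmS x hx, hmS y hy, hmS _ hxy]
    linarith
  have h1m : 0 < m 1 := h0m ▸ hlt 0 h0 1 h1 (lt_of_le_of_ne (zero_le' 1) h01)
  refine ⟨fun x => m x / m 1, by simp [h0m], div_self h1m.ne', fun x hx y hy h =>
    div_lt_div_of_pos_right (hlt x hx y hy h) h1m, fun x hx y hy hxy => ?_,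
    fun r x hx hrx => by simp only [hsmul r x hx hrx, mul_div_assoc], fun x => ?_⟩
  · simp only [← sub_div]
    -- Linearity of the order decides whether the difference is truncated; `hsub'` only covers `y ≤
    -- x`.
    rcases htot x y with h | h
    · rw [le_iff.1 h, h0m, zero_div, max_eq_left]
      exact div_nonpos_of_nonpos_of_nonneg (sub_nonpos.2 (hle x hx y hy h)) h1m.le
    · rw [hsub' x hx y hy hxy h, max_eq_right]
      exact div_nonneg (sub_nonneg.2 (hle y hy x hx h)) h1m.le
  · by_cases hx : x ∈ S
    · refine ⟨div_nonneg (h0m ▸ hle 0 h0 x hx (zero_le' x)) h1m.le, ?_⟩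
      exact (div_le_one h1m).2 (hle x hx 1 h1 (le_one' x))
    · simp [hm, hx]

end RieszBCK

/-! ### Infima, prelinearity and iterated subtraction. -/

namespace RieszBCK

variable {A : Type*} [RieszBCK A]

/-- `x - (x - y)` is the infimum of `x` and `y`; this is its universal property. -/
theorem le_sub_sub {x y z : A} (hx : z ≤ x) (hy : z ≤ y) : z ≤ x - (x - y) := by
  rw [← sub_sub_of_le hx]
  exact sub_le_sub_left' (sub_le_sub_left' hy x) x

theorem sub_sub_le (x y : A) : x - (x - y) ≤ y := by
  rw [inf_comm']
  exact sub_le' _ _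

/-- Prelinearity. -/
theorem sub_inf_sub (x y : A) : (x - y) - ((x - y) - (y - x)) = 0 := by
  -- With `c` the infimum of the two differences and `m` that of `x` and `y`, the sum `c + m` is
  -- below both `x` and `y`, hence below `m`. Cancelling `m` leaves `c = 0`.
  set c := (x - y) - ((x - y) - (y - x)) with hc
  set m := x - (x - y) with hm
  have hc₁ : c ≤ x - y := sub_le' _ _
  have hc₂ : c ≤ y - x := sub_sub_le _ _
  have hmx : m ≤ x - c := sub_le_sub_left' hc₁ x
  have hmy : m ≤ y - c := by
    rw [hm, inf_comm']
    exact sub_le_sub_left' hc₂ y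
  have h : c + m ≤ m := by
    rw [add_comm]
    refine le_sub_sub ?_ ?_
    · exact (add_le_add_left' hmx c).trans (sub_add_of_le (hc₁.trans (sub_le' _ _))).le
    · exact (add_le_add_left' hmy c).trans (sub_add_of_le (hc₂.trans (sub_le' _ _))).le
  have hcm : c ≤ 1 - m := by
    rw [← one_sub_one_sub c]
    exact sub_le_sub_left' (hmx.trans (sub_le_sub_right' (le_one' x) c)) 1
  rw [← add_sub_of_le hcm]
  exact h

theorem iterate_sub_mono (b : A) (m : ℕ) {x y : A} (h : x ≤ y) :
    (· - b)^[m] x ≤ (· - b)^[m] y :=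
  Monotone.iterate (fun _ _ h => sub_le_sub_right' h b) m h

/-- The ideals generated by `a` and `b` meet in `0` when the infimum of `a` and `b` is `0`.
Induction applied to `u - a` gives `u ≤ a`; then `u` and `b` have infimum `0`, so subtracting `b`
leaves `u` unchanged. -/
theorem eq_zero_of_iterate_sub {a b : A} (hab : a - (a - b) = 0) {k m : ℕ} {u : A}
    (ha : (· - a)^[k] u = 0) (hb : (· - b)^[m] u = 0) : u = 0 := by
  induction k generalizing u with
  | zero => exact ha
  | succ k ih =>
    have h₁ : u - a = 0 :=
      ih ha (eq_zero_of_le (hb ▸ iterate_sub_mono b m (sub_le' u a)))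
    have h₂ : u - b = u := by
      refine le_antisymm (sub_le' _ _) ?_
      rw [le_iff, inf_comm']
      refine eq_zero_of_le ?_
      rw [← hab, inf_comm' a]
      exact sub_le_sub_left' (sub_le_sub_left' h₁ b) b
    rwa [Function.iterate_fixed h₂] at hb

end RieszBCK

/-! ### Theories and their Lindenbaum–Tarski algebras. -/

open Form Provable

namespace Provable

variable {n : ℕ}

theorem exchange_imp (φ ψ χ : Form n) :
    Provable (imp (imp φ (imp ψ χ)) (imp ψ (imp φ χ))) :=
  exchange ((assertion ψ χ).trans (exchange (L2 φ (imp ψ χ) χ)))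

/-- Necessitation as a theorem rather than a rule, so that it is available inside any theory. -/
theorem imp_nabla (r : I) (φ : Form n) : Provable (imp φ (nabla r φ)) := by
  have e : odot r (RieszMVOps.mvStar 1) = odot r (RieszMVOps.mvStar r) := by
    apply Subtype.ext
    rw [RieszBCK.odot_star_coe, RieszBCK.odot_star_coe, Set.Icc.coe_one, sub_self, max_self,
      max_eq_left (sub_nonpos.2 r.2.2)]
  exact (R4' φ).trans ((R2 r 1 φ).mp (e ▸ nabla_zero φ r))

/-- Together with `iterate_exchange` this gives the local deduction theorem: without contraction the
uses of `φ` are counted, and modus ponens adds the counts. -/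
theorem iterate_congr (φ χ ξ : Form n) (k : ℕ) :
    Provable (imp (imp χ ξ) (imp ((imp φ)^[k] χ) ((imp φ)^[k] ξ))) := by
  induction k with
  | zero => exact refl _
  | succ k ih =>
    rw [Function.iterate_succ_apply', Function.iterate_succ_apply']
    exact ih.trans (exchange (L2 _ _ _))

theorem iterate_exchange (φ χ ξ : Form n) (k : ℕ) :
    Provable (imp ((imp φ)^[k] (imp χ ξ)) (imp χ ((imp φ)^[k] ξ))) := by
  induction k with
  | zero => exact refl _
  | succ k ih =>
    rw [Function.iterate_succ_apply', Function.iterate_succ_apply']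
    exact (imp_congr (refl φ) ih).trans (exchange_imp _ _ _)

end Provable

/-- A deductively closed set of formulas. -/
structure Theory (n : ℕ) where
  carrier : Set (Form n)
  provable_mem : ∀ {φ}, Provable φ → φ ∈ carrier
  mp : ∀ {φ ψ}, imp φ ψ ∈ carrier → φ ∈ carrier → ψ ∈ carrier

namespace Theory

variable {n : ℕ}

/-- The theory generated by a theory and a formula. -/
def adjoin (T : Theory n) (φ : Form n) : Theory n where
  carrier := {χ | ∃ k, (imp φ)^[k] χ ∈ T.carrier}
  provable_mem h := ⟨0, T.provable_mem h⟩
  mp := by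
    rintro χ ξ ⟨m, hm⟩ ⟨k, hk⟩
    refine ⟨k + m, ?_⟩
    rw [Function.iterate_add_apply]
    exact T.mp (T.mp (T.provable_mem (iterate_congr φ χ _ k))
      (T.mp (T.provable_mem (iterate_exchange φ χ ξ m)) hm)) hk

/-- A union of a chain of theories is a theory because modus ponens has two premises. Maximality is
read through `adjoin`: a theory properly larger than `T` contains `ψ`. -/
theorem exists_maximal {ψ : Form n} (hψ : ¬ Provable ψ) : ∃ T : Theory n, ψ ∉ T.carrier ∧
    ∀ φ ∉ T.carrier, ∃ k, (imp φ)^[k] ψ ∈ T.carrier := by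
  obtain ⟨M, -, hM⟩ := zorn_subset_nonempty
    {s : Set (Form n) | ψ ∉ s ∧ ∃ T : Theory n, T.carrier = s} (by
      intro c hc hchain hne
      refine ⟨⋃₀ c, ⟨fun ⟨s, hs, h⟩ => (hc hs).1 h, ⟨⋃₀ c, ?_, ?_⟩, rfl⟩,
        fun s hs => Set.subset_sUnion_of_mem hs⟩
      · intro φ h
        obtain ⟨s, hs⟩ := hne
        obtain ⟨T, rfl⟩ := (hc hs).2
        exact ⟨_, hs, T.provable_mem h⟩
      · rintro φ χ ⟨s, hs, h⟩ ⟨t, ht, h'⟩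
        rcases hchain.total hs ht with hst | hst
        · obtain ⟨T, rfl⟩ := (hc ht).2
          exact ⟨_, ht, T.mp (hst h) h'⟩
        · obtain ⟨T, rfl⟩ := (hc hs).2
          exact ⟨_, hs, T.mp h (hst h')⟩)
    {φ | Provable φ} ⟨hψ, ⟨{φ | Provable φ}, id, Provable.mp⟩, rfl⟩
  obtain ⟨⟨hψM, T, rfl⟩, hmax⟩ := hM
  refine ⟨T, hψM, fun φ hφ => ?_⟩
  by_contra hk
  refine hφ (hmax (y := (T.adjoin φ).carrier) ⟨hk, _, rfl⟩ (fun χ h => ⟨0, h⟩) ⟨1, ?_⟩)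
  exact T.provable_mem (refl φ)

variable (T : Theory n)

theorem trans {φ ψ χ : Form n} (h₁ : imp φ ψ ∈ T.carrier) (h₂ : imp ψ χ ∈ T.carrier) :
    imp φ χ ∈ T.carrier := T.mp (T.mp (T.provable_mem (L2 _ _ _)) h₁) h₂

theorem imp_congr {φ ψ φ' ψ' : Form n} (h₁ : imp φ' φ ∈ T.carrier) (h₂ : imp ψ ψ' ∈ T.carrier) :
    imp (imp φ ψ) (imp φ' ψ') ∈ T.carrier :=
  T.trans (T.mp (T.provable_mem (L2 _ _ _)) h₁)
    (T.mp (T.provable_mem (exchange (L2 φ' ψ ψ'))) h₂)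

theorem nabla_congr {φ ψ : Form n} (h : imp φ ψ ∈ T.carrier) (r : I) :
    imp (nabla r φ) (nabla r ψ) ∈ T.carrier :=
  T.mp (T.provable_mem ((imp_nabla r _).trans (R1 r φ ψ))) h

/-- Equivalence of formulas modulo a theory. -/
def setoid : Setoid (Form n) where
  r φ ψ := imp φ ψ ∈ T.carrier ∧ imp ψ φ ∈ T.carrier
  iseqv := ⟨fun φ => ⟨T.provable_mem (.refl φ), T.provable_mem (.refl φ)⟩, fun h => ⟨h.2, h.1⟩,
    fun h₁ h₂ => ⟨T.trans h₁.1 h₂.1, T.trans h₂.2 h₁.2⟩⟩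

/-- The Lindenbaum–Tarski algebra of a theory, ordered by strength: `[φ] = 0` iff `φ` belongs to
the theory. -/
def Alg : Type := Quotient T.setoid

/-- The class of a formula. -/
def cls (φ : Form n) : T.Alg := Quotient.mk T.setoid φ

variable {T}

theorem cls_eq {φ ψ : Form n} (h₁ : Provable (imp φ ψ)) (h₂ : Provable (imp ψ φ)) :
    T.cls φ = T.cls ψ := Quotient.sound ⟨T.provable_mem h₁, T.provable_mem h₂⟩

variable [NeZero n]

/-- A tautology. -/
def taut (n : ℕ) [NeZero n] : Form n := imp (var 0) (var 0)

theorem provable_taut : Provable (taut n) := refl _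

theorem cls_eq_cls_taut_iff {φ : Form n} : T.cls φ = T.cls (taut n) ↔ φ ∈ T.carrier := by
  refine ⟨fun h => ?_, fun h => Quotient.sound ⟨T.provable_mem ((L1 _ _).mp provable_taut),
    T.mp (T.provable_mem (L1 _ _)) h⟩⟩
  exact T.mp (Quotient.exact h).2 (T.provable_mem provable_taut)

theorem cls_eq_cls_taut {φ : Form n} (h : Provable φ) : T.cls φ = T.cls (taut n) :=
  cls_eq_cls_taut_iff.2 (T.provable_mem h)

/-- Reading implication backwards as subtraction puts truth at `0` and makes `∇_r` multiplication by
`r`; the axioms of the logic then become those of the class. -/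
instance : RieszBCK T.Alg where
  zero := T.cls (taut n)
  one := T.cls (neg (taut n))
  sub := Quotient.map₂ (fun φ ψ => imp ψ φ) fun _ _ h₁ _ _ h₂ =>
    ⟨T.imp_congr h₂.2 h₁.1, T.imp_congr h₂.1 h₁.2⟩
  smul r := Quotient.map' (nabla r) fun _ _ h => ⟨T.nabla_congr h.1 r, T.nabla_congr h.2 r⟩
  sub_right_comm' := by
    rintro ⟨x⟩ ⟨y⟩ ⟨z⟩
    exact cls_eq (exchange_imp _ _ _) (exchange_imp _ _ _)
  inf_comm' := by
    rintro ⟨x⟩ ⟨y⟩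
    exact cls_eq (L3 _ _) (L3 _ _)
  sub_self' := by
    rintro ⟨x⟩
    exact cls_eq_cls_taut (refl x)
  sub_zero' := by
    rintro ⟨x⟩
    exact cls_eq ((assertion _ x).mp provable_taut) (L1 _ _)
  zero_sub' := by
    rintro ⟨x⟩
    exact cls_eq_cls_taut ((L1 _ _).mp provable_taut)
  sub_one' := by
    rintro ⟨x⟩
    exact cls_eq_cls_taut ((L4 _ _).mp ((L1 _ _).mp ((not_not' _).mp provable_taut)))
  sub_sub_sub' := by
    rintro ⟨x⟩ ⟨y⟩ ⟨z⟩
    exact cls_eq_cls_taut (L2 _ _ _)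
  smul_sub' := by
    rintro r ⟨x⟩ ⟨y⟩
    exact cls_eq (R1 _ _ _) (R1' _ _ _)
  sub_smul' := by
    rintro r q ⟨x⟩
    exact cls_eq (R2 _ _ _) (R2' _ _ _)
  mul_smul' := by
    rintro r q ⟨x⟩
    exact cls_eq (R3' _ _ _) (R3 _ _ _)
  one_smul' := by
    rintro ⟨x⟩
    exact cls_eq (R4 _) (R4' _)

theorem cls_imp (φ ψ : Form n) : T.cls (imp φ ψ) = T.cls ψ - T.cls φ := rfl

theorem cls_nabla (r : I) (φ : Form n) : T.cls (nabla r φ) = r • T.cls φ := rfl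

theorem cls_neg (φ : Form n) : T.cls (neg φ) = 1 - T.cls φ := by
  change _ = T.cls (imp φ (neg (taut n)))
  exact cls_eq ((L1 _ _).trans (L4 _ _))
    ((((Provable.imp_congr (not_not φ) (refl _))).trans (L4 _ _)).trans
      ((assertion _ _).mp provable_taut))

theorem cls_eq_zero_iff {φ : Form n} : T.cls φ = 0 ↔ φ ∈ T.carrier := cls_eq_cls_taut_iff

theorem cls_iterate_imp (φ ψ : Form n) (k : ℕ) :
    T.cls ((imp φ)^[k] ψ) = (· - T.cls φ)^[k] (T.cls ψ) := by
  induction k with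
  | zero => rfl
  | succ k ih => rw [Function.iterate_succ_apply', Function.iterate_succ_apply', cls_imp, ih]

/-- If `x` and `y` were incomparable, both implications would lie outside `T`, so `ψ` would be
reached from each of them. Their classes have infimum `0` by prelinearity, which forces `ψ` into
`T`. -/
theorem total_of_maximal {ψ : Form n} (hψ : ψ ∉ T.carrier)
    (hT : ∀ φ ∉ T.carrier, ∃ k, (imp φ)^[k] ψ ∈ T.carrier) (x y : T.Alg) : x ≤ y ∨ y ≤ x := by
  induction x using Quotient.ind with | _ α
  induction y using Quotient.ind with | _ β
  by_contra! h
  obtain ⟨k, hk⟩ := hT (imp β α) fun h' => h.1 (cls_eq_zero_iff.2 h')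
  obtain ⟨m, hm⟩ := hT (imp α β) fun h' => h.2 (cls_eq_zero_iff.2 h')
  rw [← cls_eq_zero_iff, cls_iterate_imp] at hk hm
  exact hψ (cls_eq_zero_iff.1
    (RieszBCK.eq_zero_of_iterate_sub (RieszBCK.sub_inf_sub (T.cls α) (T.cls β)) hk hm))

end Theory

/-! ### Completeness. -/

/-- The set of subformulas. -/
def Form.subformulas {n : ℕ} : Form n → Set (Form n)
  | var i => {var i}
  | neg φ => insert (neg φ) φ.subformulas
  | imp φ ψ => insert (imp φ ψ) (φ.subformulas ∪ ψ.subformulas)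
  | nabla r φ => insert (nabla r φ) φ.subformulas

theorem Form.finite_subformulas {n : ℕ} (φ : Form n) : φ.subformulas.Finite := by
  induction φ with
  | var i => exact Set.finite_singleton _
  | neg φ ih => exact ih.insert _
  | imp φ ψ ih₁ ih₂ => exact (ih₁.union ih₂).insert _
  | nabla r φ ih => exact ih.insert _

theorem Form.self_mem_subformulas {n : ℕ} (φ : Form n) : φ ∈ φ.subformulas := by
  cases φ <;> simp [subformulas]

/-- Completeness: a formula with term function `1` is a theorem. -/
theorem Provable.of_eval_eq_one {n : ℕ} [NeZero n] {ψ : Form n}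
    (h : ∀ x : Fin n → I, eval x ψ = 1) : Provable ψ := by
  classical
  by_contra hψ
  obtain ⟨T, hψT, hT⟩ := Theory.exists_maximal hψ
  have hψ₀ : T.cls ψ ≠ 0 := fun h => hψT (Theory.cls_eq_zero_iff.1 h)
  have h01 : (0 : T.Alg) ≠ 1 := fun h =>
    hψ₀ (RieszBCK.eq_zero_of_le (h ▸ RieszBCK.le_one' _))
  set S : Finset T.Alg :=
    insert 0 (insert 1 (ψ.finite_subformulas.toFinset.image T.cls)) with hS
  have hmem : ∀ φ ∈ ψ.subformulas, T.cls φ ∈ S := fun φ hφ => by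
    refine Finset.mem_insert_of_mem (Finset.mem_insert_of_mem (Finset.mem_image_of_mem _ ?_))
    exact ψ.finite_subformulas.mem_toFinset.2 hφ
  have h1S : (1 : T.Alg) ∈ S := by simp [hS]
  obtain ⟨l, h0, h1, hlt, hsub, hsmul, hI⟩ :=
    RieszBCK.exists_realization (Theory.total_of_maximal hψT hT) h01 S (by simp [hS]) h1S
  -- The complement undoes the order reversal: truth is `0` in `T.Alg` and `1` in `I`.
  set x : Fin n → I := fun i => RieszMVOps.mvStar ⟨l (T.cls (var i)), hI _⟩
  have key : ∀ φ : Form n, (∀ χ ∈ φ.subformulas, T.cls χ ∈ S) →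
      (eval x φ : ℝ) = 1 - l (T.cls φ) := by
    intro φ
    induction φ with
    | var i => intro _; rfl
    | neg φ ih =>
      intro hφ
      have hφ' := fun χ hχ => hφ χ (Set.mem_insert_of_mem _ hχ)
      have hn := hφ _ (self_mem_subformulas _)
      rw [Theory.cls_neg] at hn ⊢
      rw [hsub _ h1S _ (hφ' _ φ.self_mem_subformulas) hn, h1,
        max_eq_right (sub_nonneg.2 (hI _).2)]
      simp only [eval, coe_star_I, ih hφ']
    | imp φ χ ih₁ ih₂ =>
      intro hφ
      have hφ₁ := fun ξ hξ => hφ ξ (Set.mem_insert_of_mem _ (Or.inl hξ))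
      have hφ₂ := fun ξ hξ => hφ ξ (Set.mem_insert_of_mem _ (Or.inr hξ))
      have hn := hφ _ (self_mem_subformulas _)
      rw [Theory.cls_imp] at hn ⊢
      rw [hsub _ (hφ₂ _ χ.self_mem_subformulas) _ (hφ₁ _ φ.self_mem_subformulas) hn]
      simp only [eval, coe_oplus_I, coe_star_I, ih₁ hφ₁, ih₂ hφ₂]
      grind
    | nabla r φ ih =>
      intro hφ
      have hφ' := fun χ hχ => hφ χ (Set.mem_insert_of_mem _ hχ)
      have hn := hφ _ (self_mem_subformulas _)
      rw [Theory.cls_nabla] at hn ⊢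
      rw [hsmul r _ (hφ' _ φ.self_mem_subformulas) hn]
      simp only [eval, coe_star_I, coe_scal_I, ih hφ']
      ring
  have hpos := hlt 0 (by simp [hS]) _ (hmem ψ ψ.self_mem_subformulas)
    (lt_of_le_of_ne (RieszBCK.zero_le' _) hψ₀.symm)
  have := key ψ hmem
  rw [h x, Set.Icc.coe_one] at this
  rw [h0] at hpos
  linarith

/-! ### Density of the term functions. -/

open Form RieszMVOps

section Density

variable {n : ℕ}

/-- The functions `x ↦ M (f_φ(x) - f_ψ(x))` with `M ≥ 0`: the vector lattice spanned by the term
functions. -/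
def termSpan (n : ℕ) : Set C(Fin n → I, ℝ) :=
  {g | ∃ M : ℝ, 0 ≤ M ∧ ∃ φ ψ : Form n, ∀ x, g x = M * ((eval x φ : ℝ) - eval x ψ)}

theorem eval_delta (x : Fin n → I) (r : I) (φ : Form n) :
    (eval x (delta r φ) : ℝ) = r * eval x φ := by
  simp [delta, eval]

theorem eval_neg_imp (x : Fin n → I) (φ ψ : Form n) :
    (eval x (imp (neg φ) ψ) : ℝ) = min 1 ((eval x φ : ℝ) + eval x ψ) := by
  simp [eval]

theorem eval_sub (x : Fin n → I) (φ ψ : Form n) :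
    (eval x (neg (imp φ ψ)) : ℝ) = max 0 ((eval x φ : ℝ) - eval x ψ) := by
  simp only [eval, coe_oplus_I, coe_star_I]
  grind

theorem neg_mem_termSpan {g : C(Fin n → I, ℝ)} (hg : g ∈ termSpan n) : -g ∈ termSpan n := by
  obtain ⟨M, hM, φ, ψ, h⟩ := hg
  refine ⟨M, hM, ψ, φ, fun x => ?_⟩
  rw [ContinuousMap.neg_apply, h]
  ring

theorem smul_mem_termSpan (c : ℝ) {g : C(Fin n → I, ℝ)} (hg : g ∈ termSpan n) :
    c • g ∈ termSpan n := by
  have key : ∀ c : ℝ, 0 ≤ c → c • g ∈ termSpan n := by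
    intro c hc
    obtain ⟨M, hM, φ, ψ, h⟩ := hg
    refine ⟨c * M, mul_nonneg hc hM, φ, ψ, fun x => ?_⟩
    rw [ContinuousMap.smul_apply, h, smul_eq_mul, mul_assoc]
  rcases le_total 0 c with hc | hc
  · exact key c hc
  · rw [← neg_smul_neg, smul_neg]
    exact neg_mem_termSpan (key _ (neg_nonneg.2 hc))

theorem posPart_mem_termSpan {g : C(Fin n → I, ℝ)} (hg : g ∈ termSpan n) :
    g ⊔ 0 ∈ termSpan n := by
  obtain ⟨M, hM, φ, ψ, h⟩ := hg
  refine ⟨M, hM, neg (imp φ ψ), neg (imp φ φ), fun x => ?_⟩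
  rw [ContinuousMap.sup_apply, h, eval_sub, eval_sub, sub_self, max_self, sub_zero,
    mul_max_of_nonneg _ _ hM, mul_zero, sup_comm]
  rfl

/-- Convex combinations of term functions are term functions. -/
theorem exists_eval_convex (φ ψ : Form n) {t : ℝ} (ht : t ∈ I) : ∃ χ : Form n, ∀ x,
    (eval x χ : ℝ) = t * eval x φ + (1 - t) * eval x ψ := by
  refine ⟨imp (neg (delta ⟨t, ht⟩ φ)) (delta (σ ⟨t, ht⟩) ψ), fun x => ?_⟩
  rw [eval_neg_imp, eval_delta, eval_delta, coe_symm_eq, min_eq_right]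
  have h₁ := mul_le_mul_of_nonneg_left (eval x φ).2.2 ht.1
  have h₂ := mul_le_mul_of_nonneg_left (eval x ψ).2.2 (sub_nonneg.2 ht.2)
  change t * _ + _ ≤ 1
  linarith

/-- Factoring out `M + N` leaves convex combinations of term functions, where `⊕` does not truncate.
-/
theorem add_mem_termSpan {f g : C(Fin n → I, ℝ)} (hf : f ∈ termSpan n) (hg : g ∈ termSpan n) :
    f + g ∈ termSpan n := by
  obtain ⟨M, hM, φ, ψ, h⟩ := hf
  obtain ⟨N, hN, φ', ψ', h'⟩ := hg
  rcases (add_nonneg hM hN).eq_or_lt with h₀ | h₀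
  · refine ⟨0, le_rfl, φ, ψ, fun x => ?_⟩
    obtain rfl : M = 0 := by linarith
    obtain rfl : N = 0 := by linarith
    simp [h, h']
  · have ht : M / (M + N) ∈ I := ⟨by positivity, (div_le_one h₀).2 (by linarith)⟩
    obtain ⟨χ, hχ⟩ := exists_eval_convex φ φ' ht
    obtain ⟨χ', hχ'⟩ := exists_eval_convex ψ ψ' ht
    refine ⟨M + N, h₀.le, χ, χ', fun x => ?_⟩
    rw [ContinuousMap.add_apply, h, h', hχ, hχ']
    field_simp
    ring

theorem sup_mem_termSpan {f g : C(Fin n → I, ℝ)} (hf : f ∈ termSpan n) (hg : g ∈ termSpan n) :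
    f ⊔ g ∈ termSpan n := by
  have e : f ⊔ g = g + ((f + -g) ⊔ 0) := by
    ext x
    simp only [ContinuousMap.sup_apply, ContinuousMap.add_apply, ContinuousMap.neg_apply,
      ContinuousMap.zero_apply]
    grind
  rw [e]
  exact add_mem_termSpan hg (posPart_mem_termSpan (add_mem_termSpan hf (neg_mem_termSpan hg)))

theorem inf_mem_termSpan {f g : C(Fin n → I, ℝ)} (hf : f ∈ termSpan n) (hg : g ∈ termSpan n) :
    f ⊓ g ∈ termSpan n := by
  have e : f ⊓ g = -(-f ⊔ -g) := by
    ext x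
    simp only [ContinuousMap.sup_apply, ContinuousMap.inf_apply, ContinuousMap.neg_apply]
    grind
  rw [e]
  exact neg_mem_termSpan (sup_mem_termSpan (neg_mem_termSpan hf) (neg_mem_termSpan hg))

/-- Truncations to `[0,1]` of functions in the span are term functions. -/
theorem exists_eval_eq_truncate {g : C(Fin n → I, ℝ)} (hg : g ∈ termSpan n) :
    ∃ φ : Form n, ∀ x, (eval x φ : ℝ) = max 0 (min 1 (g x)) := by
  obtain ⟨M, hM, φ, ψ, h⟩ := hg
  -- `M` may exceed `1`, so `Δ` is applied with the legal scalar `M / N`, and an `N`-fold `⊕`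
  -- restores the factor while truncating at `1`.
  obtain ⟨N, hN⟩ := exists_nat_gt M
  have hN₀ : (0 : ℝ) < N := hM.trans_lt hN
  have hr : M / N ∈ I := ⟨by positivity, (div_le_one hN₀).2 hN.le⟩
  set χ := delta ⟨M / N, hr⟩ (neg (imp φ ψ)) with hχ
  have key : ∀ k : ℕ, ∃ ξ : Form n, ∀ x, (eval x ξ : ℝ) = min 1 (k * (eval x χ : ℝ)) := by
    intro k
    induction k with
    | zero => exact ⟨neg (imp φ φ), fun x => by rw [eval_sub]; simp⟩
    | succ k ih =>
      obtain ⟨ξ, hξ⟩ := ih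
      refine ⟨imp (neg ξ) χ, fun x => ?_⟩
      rw [eval_neg_imp, hξ]
      have := (eval x χ).2.1
      push_cast
      rw [add_mul, one_mul]
      grind
  obtain ⟨ξ, hξ⟩ := key N
  refine ⟨ξ, fun x => ?_⟩
  rw [hξ, h, hχ, eval_delta, eval_sub, ← mul_assoc]
  change min 1 ((N : ℝ) * (M / N) * _) = _
  rw [mul_div_cancel₀ _ hN₀.ne', mul_max_of_nonneg _ _ hM, mul_zero]
  grind

variable [NeZero n]

theorem one_mem_termSpan : (1 : C(Fin n → I, ℝ)) ∈ termSpan n := by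
  refine ⟨1, zero_le_one, imp (var 0) (var 0), neg (imp (var 0) (var 0)), fun x => ?_⟩
  simp [eval]

theorem const_add_smul_mem_termSpan (c d : ℝ) (i : Fin n) :
    ∃ g ∈ termSpan n, ∀ x, g x = c + d * (x i : ℝ) := by
  have hi : (⟨fun x => (x i : ℝ), by fun_prop⟩ : C(Fin n → I, ℝ)) ∈ termSpan n := by
    refine ⟨1, zero_le_one, var i, neg (imp (var 0) (var 0)), fun x => ?_⟩
    simp [eval]
  refine ⟨_, add_mem_termSpan (smul_mem_termSpan c one_mem_termSpan) (smul_mem_termSpan d hi),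
    fun x => ?_⟩
  simp

/-- Lattice form of Stone–Weierstrass. Distinct points differ in some coordinate, and an affine
function of that coordinate takes any two prescribed values. -/
theorem closure_termSpan : closure (termSpan n) = ⊤ := by
  refine ContinuousMap.sublattice_closure_eq_top _ ⟨_, one_mem_termSpan⟩
    (fun f hf g hg => inf_mem_termSpan hf hg) (fun f hf g hg => sup_mem_termSpan hf hg) ?_
  intro v x y
  by_cases h : x = y
  · obtain ⟨g, hg, e⟩ := const_add_smul_mem_termSpan (v x) 0 (0 : Fin n)
    exact ⟨g, hg, by simp [e], by simp [e, h]⟩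
  · obtain ⟨i, hi⟩ := Function.ne_iff.1 h
    have hi' : (x i : ℝ) - y i ≠ 0 := sub_ne_zero.2 (Subtype.coe_ne_coe.2 hi)
    obtain ⟨g, hg, e⟩ := const_add_smul_mem_termSpan
      (v x - (v x - v y) / ((x i : ℝ) - y i) * x i) ((v x - v y) / ((x i : ℝ) - y i)) i
    refine ⟨g, hg, by rw [e]; ring, ?_⟩
    rw [e]
    field_simp
    ring

/-- Truncation to `[0,1]` fixes the values of `f` and does not increase distances, so truncating an
approximation from `termSpan n` costs nothing. -/
theorem exists_termFun_dist_lt (f : C(Fin n → I, I)) {ε : ℝ} (hε : 0 < ε) :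
    ∃ φ : Form n, dist f φ.termFun < ε := by
  have hF : (⟨fun x => (f x : ℝ), by fun_prop⟩ : C(Fin n → I, ℝ)) ∈ closure (termSpan n) := by
    rw [closure_termSpan]
    trivial
  obtain ⟨g, hg, hd⟩ := Metric.mem_closure_iff.1 hF ε hε
  obtain ⟨φ, hφ⟩ := exists_eval_eq_truncate hg
  refine ⟨φ, (ContinuousMap.dist_lt_iff hε).2 fun x => ?_⟩
  have hx := (ContinuousMap.dist_lt_iff hε).1 hd x
  have h₁ := (f x).2
  rw [Subtype.dist_eq]
  change dist (f x : ℝ) (eval x φ : ℝ) < ε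
  rw [hφ, Real.dist_eq]
  rw [Real.dist_eq] at hx
  change |(f x : ℝ) - g x| < ε at hx
  obtain ⟨_, _⟩ := h₁
  grind

end Density

theorem supNorm_eq_dist {X : Type*} [TopologicalSpace X] [CompactSpace X] (f : C(X, I)) : supNorm f = dist f zero := by
  rw [supNorm, ContinuousMap.dist_eq_iSup]
  refine iSup_congr fun x => ?_
  change _ = |(f x : ℝ) - 0|
  rw [sub_zero, abs_of_nonneg (f x).2.1]

/-! ### The norm and the completion. -/

namespace RL

variable {n : ℕ}

theorem termFun_le_unitNorm (a : RL n) (x : Fin n → I) : (termFun a x : ℝ) ≤ unitNorm a :=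
  le_ciSup (f := fun x => (termFun a x : ℝ))
    ⟨1, by rintro _ ⟨x, rfl⟩; exact (termFun a x).2.2⟩ x

variable [NeZero n]

/-- This is where completeness enters; it makes the pseudometric on `RL n` a metric and the norm
definite. -/
theorem termFun_injective : Function.Injective (termFun : RL n → C(Fin n → I, I)) := by
  intro a b
  induction a using Quotient.ind with | _ φ
  induction b using Quotient.ind with | _ ψ
  intro h
  have h' : ∀ x, eval x φ = eval x ψ := fun x => congrArg (fun f : C(Fin n → I, I) => f x) h
  exact Quotient.sound ⟨Provable.of_eval_eq_one fun x => Provable.eval_imp_eq_one.2 (h' x ▸ le_rfl),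
    Provable.of_eval_eq_one fun x => Provable.eval_imp_eq_one.2 (h' x ▸ le_rfl)⟩

theorem denseRange_termFun : DenseRange (termFun : RL n → C(Fin n → I, I)) := by
  intro f
  refine Metric.mem_closure_iff.2 fun ε hε => ?_
  obtain ⟨φ, h⟩ := exists_termFun_dist_lt f hε
  exact ⟨_, ⟨mk φ, rfl⟩, h⟩

theorem isRieszMVNorm_unitNorm : IsRieszMVNorm (unitNorm : RL n → ℝ) where
  mem_Icc a := ⟨Real.iSup_nonneg fun x => (termFun a x).2.1, ciSup_le fun x => (termFun a x).2.2⟩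
  eq_zero_iff a := by
    rw [unitNorm_eq_dist, ← isometry_termFun.dist_eq, dist_eq_zero, termFun_injective.eq_iff]
  scal_eq r a := by
    rw [unitNorm, unitNorm, Real.mul_iSup_of_nonneg r.2.1]
    refine iSup_congr fun x => ?_
    rw [termFun_scal]
    rfl
  oplus_le a b := by
    refine ciSup_le fun x => ?_
    rw [termFun_oplus]
    exact (min_le_right _ _).trans (add_le_add (termFun_le_unitNorm a x) (termFun_le_unitNorm b x))
  mono a b h := by
    refine ciSup_le fun x => le_trans ?_ (termFun_le_unitNorm b x)
    have h' := congrArg (fun c => (termFun c x : ℝ)) h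
    simp only [termFun_oplus, termFun_star, termFun_zero] at h'
    change min 1 ((1 - (termFun a x : ℝ)) + termFun b x) = 1 - 0 at h'
    rw [sub_zero, min_eq_left_iff] at h'
    linarith

/-- The extension of `termFun` to the completion. -/
def completionTermFun : NormCompletion n → C(Fin n → I, I) := Completion.extension termFun

theorem completionTermFun_coe (a : RL n) :
    completionTermFun (a : NormCompletion n) = termFun a :=
  Completion.extension_coe isometry_termFun.uniformContinuous a

theorem isometry_completionTermFun :
    Isometry (completionTermFun : NormCompletion n → C(Fin n → I, I)) :=
  isometry_termFun.completion_extension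

/-- The isometric image of a complete space is closed, and this one contains the dense set of term
functions. -/
theorem surjective_completionTermFun :
    Function.Surjective (completionTermFun : NormCompletion n → C(Fin n → I, I)) := by
  rw [← Set.range_eq_univ,
    ← isometry_completionTermFun.isClosedEmbedding.isClosed_range.closure_eq]
  refine Set.eq_univ_of_univ_subset fun f _ => closure_mono ?_ (denseRange_termFun f)
  rintro _ ⟨a, rfl⟩
  exact ⟨a, completionTermFun_coe a⟩

theorem continuous_completionTermFun_apply (x : Fin n → I) :
    Continuous fun a : NormCompletion n => completionTermFun a x :=
  (continuous_eval_const x).comp isometry_completionTermFun.continuous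

theorem isRieszMVIso_completionTermFun :
    IsRieszMVIso (completionTermFun : NormCompletion n → C(Fin n → I, I)) where
  bijective := ⟨isometry_completionTermFun.injective, surjective_completionTermFun⟩
  map_zero := (completionTermFun_coe zero).trans termFun_zero
  map_star a := by
    -- At a fixed point `x` both sides are continuous in `a`, so the identity need only be checked
    -- on the dense image of `RL n`.
    ext1 x
    refine Completion.induction_on a (isClosed_eq
      ((continuous_completionTermFun_apply x).comp Completion.continuous_map)
      (continuous_star_I.comp (continuous_completionTermFun_apply x))) fun a => ?_
    rw [coe_star, completionTermFun_coe, completionTermFun_coe, termFun_star]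
  map_oplus a b := by
    ext1 x
    refine Completion.induction_on₂ a b (isClosed_eq
      ((continuous_completionTermFun_apply x).comp
        (Completion.continuous_map₂ continuous_fst continuous_snd))
      (continuous_oplus_I.comp (((continuous_completionTermFun_apply x).comp continuous_fst).prodMk
        ((continuous_completionTermFun_apply x).comp continuous_snd)))) fun a b => ?_
    rw [coe_oplus, completionTermFun_coe, completionTermFun_coe, completionTermFun_coe,
      termFun_oplus]
  map_scal r a := by
    ext1 x
    refine Completion.induction_on a (isClosed_eq
      ((continuous_completionTermFun_apply x).comp Completion.continuous_map)
      ((continuous_scal_I r).comp (continuous_completionTermFun_apply x))) fun a => ?_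
    rw [coe_scal, completionTermFun_coe, completionTermFun_coe, termFun_scal]

theorem supNorm_completionTermFun (a : NormCompletion n) :
    supNorm (completionTermFun a) = completionNorm a := by
  refine Completion.induction_on a (isClosed_eq ?_ Completion.continuous_extension) fun a => ?_
  · simp only [supNorm_eq_dist]
    exact isometry_completionTermFun.continuous.dist continuous_const
  · rw [completionTermFun_coe, completionNorm_coe]
    rfl

end RL
end RieszLuk

end

open RieszLuk RieszMVOps
theorem mainTheorem4 (n : ℕ) [NeZero n] :
    IsRieszMVNorm (RL.unitNorm : RL n → ℝ) ∧
    (∃ Φ : RL.NormCompletion n ≃ᵢ C(Fin n → I, I),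
      IsRieszMVIso Φ ∧
      (∀ x : RL.NormCompletion n, supNorm (Φ x) = RL.completionNorm x) ∧
      ∀ φ : Form n, Φ (RL.mk φ : RL.NormCompletion n) = φ.termFun) ∧
    (∀ f : (Fin n → I) → I, Continuous f →
      ∃ φ : ℕ → Form n, TendstoUniformly (fun k => ⇑(φ k).termFun) f atTop) := by
  refine ⟨RL.isRieszMVNorm_unitNorm,
    ⟨⟨Equiv.ofBijective _ RL.isRieszMVIso_completionTermFun.bijective,
      RL.isometry_completionTermFun⟩, RL.isRieszMVIso_completionTermFun,
      RL.supNorm_completionTermFun, fun φ => RL.completionTermFun_coe (RL.mk φ)⟩,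
    fun f hf => ?_⟩
  choose φ hφ using fun k : ℕ =>
    exists_termFun_dist_lt ⟨f, hf⟩ (Nat.one_div_pos_of_nat (α := ℝ) (n := k))
  refine ⟨φ, Metric.tendstoUniformly_iff.2 fun ε hε => ?_⟩
  filter_upwards [tendsto_one_div_add_atTop_nhds_zero_nat.eventually_lt_const hε] with k hk x
  exact (ContinuousMap.dist_apply_le_dist (f := ⟨f, hf⟩) x).trans_lt ((hφ k).trans hk)
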